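/- For positive integers $g,n$ let $N=gn$ and let $|\varphi\rangle = 2^{-n/2}\sum_{j=0}^{n}\sqrt{\binom nj}\,|D^{N}_{gj}\rangle$ be the gnu probe state (with scaling parameter $u=1$), where $|D^N_w\rangle=\binom Nw^{-1/2}\sum_{x\in\{0,1\}^N,\ x_1+\dots+x_N=w}|x_1\rangle\otimes\dots\otimes|x_N\rangle$ is the $N$-qubit Dicke state of weight $w$. Let $\rho$ be the state of the remaining $N-t$ qubits after tracing out $t$ of the $N$ qubits of $|\varphi\rangle\langle\varphi|$, and let $H=\sum_i Z_i$ be the sum of the Pauli $Z$ operators on the remaining qubits. Let $F=\operatorname{tr}(\rho L^2)$ be the quantum Fisher information (QFI) of $\rho$ with respect to $H$, where $L$ is a Hermitian solution (symmetric logarithmic derivative) of $-i[H,\rho]=\tfrac12(\rho L+L\rho)$. Fix $n$ and $t\in\{1,2\}$ with $t<n$. Then for all sufficiently large $g$ (depending on $n$), and for every choice of the $t$ erased qubits, $$F\ \ge\ \frac{n-1}{n^2}\bigl(N^2+(n-2)N-(n-1)\bigr)\qquad\text{if } t=1,$$ $$F\ \ge\ \frac{(N-2)(n-1)\bigl(N(3n^2-n+6)+3n^3-4n^2+3n-18\bigr)}{8n^4}\qquad\text{if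 } t=2.$$ In particular, Heisenberg scaling holds up to a constant: there is $c>0$, depending only on $n$ and $t$, such that $F\ge cN^2$ for all sufficiently large $g$ and every choice of the $t$ erased qubits. -/

import Mathlib

open Filter
open scoped Matrix ComplexOrder

/-- Computational basis labels of a register of qubits indexed by `ι`. -/
abbrev Bits (ι : Type) : Type := ι → Fin 2

/-- The number of ones in a bit string. -/
def hammingWt {ι : Type} [Fintype ι] (x : Bits ι) : ℕ := ∑ i, (x i : ℕ)

/-- The Dicke state of weight `w` on the qubits `ι`: the normalized uniform superposition of all
computational basis states with exactly `w` ones. -/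
noncomputable def dicke (ι : Type) [Fintype ι] (w : ℕ) : Bits ι → ℂ :=
  fun x => if hammingWt x = w then ((1 / Real.sqrt ((Fintype.card ι).choose w) : ℝ) : ℂ) else 0

/-- The gnu probe state with scaling parameter `u = 1`, a state of `N = g * n` qubits:
`√(2⁻ⁿ) ∑_{j=0}^{n} √(n choose j) |D^N_{gj}⟩`. -/
noncomputable def gnuProbe (g n : ℕ) : Bits (Fin (g * n)) → ℂ :=
  fun x => ((Real.sqrt ((2 : ℝ)⁻¹ ^ n) : ℝ) : ℂ) *
    ∑ j ∈ Finset.range (n + 1),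
      ((Real.sqrt (n.choose j) : ℝ) : ℂ) * dicke (Fin (g * n)) (g * j) x

/-- The rank-one operator `|ψ⟩⟨ψ|`. -/
def ketBra {κ : Type} (ψ : κ → ℂ) : Matrix κ κ ℂ := Matrix.vecMulVec ψ (star ψ)

/-- The bit string on all qubits that is `z` on the qubits in `S` and `x` on the others. -/
def glue {ι : Type} [DecidableEq ι] (S : Finset ι) (z : Bits {i // i ∈ S})
    (x : Bits {i // i ∉ S}) : Bits ι :=
  fun i => if h : i ∈ S then z ⟨i, h⟩ else x ⟨i, h⟩

/-- Partial trace over the qubits in `S`; the result is an operator on the remaining qubits. -/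
def eraseQubits {ι : Type} [DecidableEq ι] (S : Finset ι) (ρ : Matrix (Bits ι) (Bits ι) ℂ) :
    Matrix (Bits {i // i ∉ S}) (Bits {i // i ∉ S}) ℂ :=
  fun x y => ∑ z : Bits {i // i ∈ S}, ρ (glue S z x) (glue S z y)

/-- The Pauli operator `Z` on qubit `j`, tensored with the identity on all other qubits. -/
def pauliZ {ι : Type} [Fintype ι] [DecidableEq ι] (j : ι) : Matrix (Bits ι) (Bits ι) ℂ :=
  Matrix.diagonal fun x => (-1) ^ (x j : ℕ)

/-- The generator `H = ∑ⱼ Zⱼ`. -/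
def generatorZ (ι : Type) [Fintype ι] [DecidableEq ι] : Matrix (Bits ι) (Bits ι) ℂ :=
  ∑ j, pauliZ j

section QFI

variable {κ : Type} [Fintype κ]

/-- `L` is a symmetric logarithmic derivative at `ρ` of the family
`ρ_χ = exp(-iχH) ρ exp(iχH)`: it is Hermitian and `∂_χ ρ_χ = -i[H, ρ] = (ρ L + L ρ) / 2`. -/
def IsSLD (ρ H L : Matrix κ κ ℂ) : Prop :=
  L.IsHermitian ∧ (-Complex.I) • (H * ρ - ρ * H) = (1 / 2 : ℂ) • (ρ * L + L * ρ)

open Classical in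
/-- The quantum Fisher information `tr (ρ L²)` of the state `ρ` with respect to the generator `H`,
where `L` is a symmetric logarithmic derivative. For Hermitian `H` it exists whenever `ρ` is
positive semidefinite (`IsSLD.exists`), and the value does not depend on it (`IsSLD.qfi_eq`). -/
noncomputable def qfi (ρ H : Matrix κ κ ℂ) : ℝ :=
  if h : ∃ L, IsSLD ρ H L then (ρ * (h.choose * h.choose)).trace.re else 0

theorem IsSLD.trace_eq {ρ H L M : Matrix κ κ ℂ} (hL : IsSLD ρ H L) (hM : IsSLD ρ H M) :
    (ρ * (L * L)).trace = (ρ * (M * M)).trace := by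
  have h2 : ρ * L + L * ρ = ρ * M + M * ρ := by
    have h := hL.2.symm.trans hM.2
    exact smul_right_injective _ (by norm_num : (1 / 2 : ℂ) ≠ 0) h
  have e1 : ((ρ * L + L * ρ) * L).trace = ((ρ * M + M * ρ) * L).trace := by rw [h2]
  have e2 : ((ρ * L + L * ρ) * M).trace = ((ρ * M + M * ρ) * M).trace := by rw [h2]
  simp only [Matrix.add_mul, Matrix.trace_add, Matrix.mul_assoc] at e1 e2
  have a1 : (L * (ρ * L)).trace = (ρ * (L * L)).trace := by
    rw [Matrix.trace_mul_comm, Matrix.mul_assoc]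
  have a2 : (M * (ρ * M)).trace = (ρ * (M * M)).trace := by
    rw [Matrix.trace_mul_comm, Matrix.mul_assoc]
  have a3 : (M * (ρ * L)).trace = (ρ * (L * M)).trace := by
    rw [Matrix.trace_mul_comm, Matrix.mul_assoc]
  have a4 : (L * (ρ * M)).trace = (ρ * (M * L)).trace := by
    rw [Matrix.trace_mul_comm, Matrix.mul_assoc]
  rw [a1, a3] at e1
  rw [a2, a4] at e2
  have h : (2 : ℂ) * (ρ * (L * L)).trace = 2 * (ρ * (M * M)).trace := by
    linear_combination e1 + e2
  exact mul_left_cancel₀ two_ne_zero h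

theorem IsSLD.qfi_eq {ρ H L : Matrix κ κ ℂ} (hL : IsSLD ρ H L) :
    qfi ρ H = (ρ * (L * L)).trace.re := by
  have h : ∃ L, IsSLD ρ H L := ⟨L, hL⟩
  rw [qfi, dif_pos h, IsSLD.trace_eq h.choose_spec hL]

theorem IsSLD.exists [DecidableEq κ] {ρ H : Matrix κ κ ℂ} (hρ : ρ.PosSemidef)
    (hH : H.IsHermitian) : ∃ L, IsSLD ρ H L := by
  set U : Matrix κ κ ℂ := (hρ.1.eigenvectorUnitary : Matrix κ κ ℂ) with hU
  set e := hρ.1.eigenvalues with he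
  set Λ : Matrix κ κ ℂ := Matrix.diagonal fun i => (e i : ℂ) with hΛ
  have hUU : Uᴴ * U = 1 := Matrix.mem_unitaryGroup_iff'.1 hρ.1.eigenvectorUnitary.2
  have hUU' : U * Uᴴ = 1 := Matrix.mem_unitaryGroup_iff.1 hρ.1.eigenvectorUnitary.2
  have hsp : ρ = U * Λ * Uᴴ := by
    have := hρ.1.spectral_theorem
    rw [Unitary.conjStarAlgAut_apply] at this
    exact this
  set K : Matrix κ κ ℂ := Uᴴ * H * U with hK
  have hKh : Kᴴ = K := by
    simp [hK, Matrix.conjTranspose_mul, hH.eq, Matrix.mul_assoc]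
  have hHK : H = U * K * Uᴴ := by
    calc H = (U * Uᴴ) * H * (U * Uᴴ) := by simp [hUU']
      _ = _ := by simp only [hK, Matrix.mul_assoc]
  set M : Matrix κ κ ℂ :=
    Matrix.of fun i j => 2 * Complex.I * ((e i - e j : ℝ) / (e i + e j : ℝ)) * K i j with hM
  have hMh : Mᴴ = M := by
    ext i j
    have hk : star (K j i) = K i j := by
      conv_rhs => rw [← hKh]
      rfl
    simp only [Matrix.conjTranspose_apply, hM, Matrix.of_apply, star_mul', hk]
    simp only [RCLike.star_def, map_div₀, Complex.conj_ofReal, Complex.conj_I, map_ofNat]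
    rw [show e j - e i = -(e i - e j) by ring, add_comm (e j) (e i)]
    push_cast
    ring
  have key : (-Complex.I) • (K * Λ - Λ * K) = (1 / 2 : ℂ) • (Λ * M + M * Λ) := by
    ext i j
    simp only [hΛ, hM, Matrix.smul_apply, Matrix.sub_apply, Matrix.add_apply,
      Matrix.mul_diagonal, Matrix.diagonal_mul, Matrix.of_apply, smul_eq_mul]
    by_cases h0 : e i + e j = 0
    · have hi : 0 ≤ e i := hρ.eigenvalues_nonneg i
      have hj : 0 ≤ e j := hρ.eigenvalues_nonneg j
      have h1 : e i = 0 := by linarith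
      have h2 : e j = 0 := by linarith
      simp [h1, h2]
    · have h0' : (e i : ℂ) + e j ≠ 0 := by exact_mod_cast h0
      push_cast
      field_simp
      ring
  have conj : ∀ A B : Matrix κ κ ℂ, (U * A * Uᴴ) * (U * B * Uᴴ) = U * (A * B) * Uᴴ := by
    intro A B
    calc (U * A * Uᴴ) * (U * B * Uᴴ) = U * A * (Uᴴ * U) * B * Uᴴ := by
          simp only [Matrix.mul_assoc]
      _ = _ := by simp only [hUU, Matrix.mul_one, Matrix.mul_assoc]
  refine ⟨U * M * Uᴴ, ?_, ?_⟩
  · show (U * M * Uᴴ)ᴴ = _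
    simp [Matrix.conjTranspose_mul, hMh, Matrix.mul_assoc]
  · rw [hsp, hHK]
    simp only [conj]
    rw [← Matrix.sub_mul, ← Matrix.mul_sub, ← Matrix.add_mul, ← Matrix.mul_add,
      ← Matrix.smul_mul, ← Matrix.mul_smul, ← Matrix.smul_mul, ← Matrix.mul_smul, key]

end QFI

/-- The quantum Fisher information that remains in the gnu probe state on `N = g * n` qubits after
the qubits in `S` have been erased; the generator is `∑ Zᵢ` over the qubits that are left. -/
noncomputable def erasedProbeQFI (g n : ℕ) (S : Finset (Fin (g * n))) : ℝ :=
  qfi (eraseQubits S (ketBra (gnuProbe g n))) (generatorZ {i // i ∉ S})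

/-!
Erasing `t < g` qubits turns the probe state into a mixture of branches `ψ_k`, one for each content
of the erased register, where `k` is the number of ones lost. The weights present in the probe
state are multiples of `g`, so those in `ψ_k` are congruent to `-k` modulo `g`, and different
branches live on disjoint sets of basis states, which the diagonal generator `H = ∑ Zᵢ` preserves.
The quantum Fisher information is therefore the sum of the contributions of the branches, and each
of them is four times the variance of `H` in the branch.

The branches with `k = 1` alone suffice. There the weight is `g (i + 1) - 1`, where `i` follows a
binomial distribution with `n - t` trials and success probability `1/2`, up to a factor, because
`C(N-1, gj-1) / C(N, gj) = j / n` for `t = 1`, and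
`C(N-2, gj-1) / C(N, gj) = gj (N - gj) / (N (N - 1))` for `t = 2`. As `H` moves by `2g` when `i`
moves by one, its variance is of order `g²`, and one gets

* `F ≥ 2 (n - 1) / n² · N²` for `t = 1` (`erasedProbeQFI_ge_one`),
* `F ≥ 2 (n - 1) (n - 2) / n³ · N²` for `t = 2` (`erasedProbeQFI_ge_two`).

The leading coefficients exceed those of the claimed bounds when `n > t`, and the lower order terms
are absorbed for large `g`. That a branch contributes its variance is `qfi_ge_of_decomposition`, the
splitting into branches is `eraseQubits_gnuProbe`, and the weight distribution of the branch enters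
through `erasedProbeQFI_ge_of_binomial`.
-/

/-! ### Moments of the symmetric binomial distribution -/

theorem bernsteinPolynomial_eval_half {p i : ℕ} (hi : i ∈ Finset.range (p + 1)) :
    (bernsteinPolynomial ℝ p i).eval (2⁻¹ : ℝ) = p.choose i * 2⁻¹ ^ p := by
  have hi : i ≤ p := Nat.lt_succ_iff.1 (Finset.mem_range.1 hi)
  simp only [bernsteinPolynomial, Polynomial.eval_mul, Polynomial.eval_pow, Polynomial.eval_sub,
    Polynomial.eval_X, Polynomial.eval_one, Polynomial.eval_natCast]
  rw [show (1 : ℝ) - 2⁻¹ = 2⁻¹ by norm_num, mul_assoc, ← pow_add, Nat.add_sub_cancel' hi]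

theorem sum_choose_mul_sub_half (p : ℕ) :
    ∑ i ∈ Finset.range (p + 1), (p.choose i : ℝ) * ((i : ℝ) - p / 2) = 0 := by
  have h := congrArg (Polynomial.eval (2⁻¹ : ℝ)) (bernsteinPolynomial.sum_smul ℝ p)
  have h0 := congrArg (Polynomial.eval (2⁻¹ : ℝ)) (bernsteinPolynomial.sum ℝ p)
  simp only [Polynomial.eval_finsetSum, nsmul_eq_mul, Polynomial.eval_mul,
    Polynomial.eval_natCast, Polynomial.eval_X, Polynomial.eval_one] at h h0
  rw [Finset.sum_congr rfl fun i hi => by rw [bernsteinPolynomial_eval_half hi]] at h h0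
  have h2 : (2⁻¹ : ℝ) ^ p ≠ 0 := by positivity
  apply mul_left_cancel₀ h2
  rw [Finset.mul_sum, mul_zero]
  calc _ = ∑ i ∈ Finset.range (p + 1), (i : ℝ) * (p.choose i * 2⁻¹ ^ p)
        - p / 2 * ∑ i ∈ Finset.range (p + 1), (p.choose i * (2⁻¹ : ℝ) ^ p) := by
        rw [Finset.mul_sum, ← Finset.sum_sub_distrib]
        exact Finset.sum_congr rfl fun i _ => by ring
    _ = 0 := by rw [h, h0]; ring

theorem sum_choose_mul_sub_half_sq (p : ℕ) :
    ∑ i ∈ Finset.range (p + 1), (p.choose i : ℝ) * ((i : ℝ) - p / 2) ^ 2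
      = (2 : ℝ) ^ p * p / 4 := by
  have h := congrArg (Polynomial.eval (2⁻¹ : ℝ)) (bernsteinPolynomial.variance ℝ p)
  simp only [Polynomial.eval_finsetSum, nsmul_eq_mul, Polynomial.eval_mul, Polynomial.eval_sub,
    Polynomial.eval_pow,
    Polynomial.eval_natCast, Polynomial.eval_X, Polynomial.eval_one] at h
  rw [Finset.sum_congr rfl fun i hi => by rw [bernsteinPolynomial_eval_half hi]] at h
  have h2 : (2⁻¹ : ℝ) ^ p ≠ 0 := by positivity
  apply mul_left_cancel₀ h2
  rw [Finset.mul_sum]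
  have h3 : (2⁻¹ : ℝ) ^ p * 2 ^ p = 1 := by rw [← mul_pow]; norm_num
  calc _ = ∑ i ∈ Finset.range (p + 1), ((p : ℝ) * 2⁻¹ - i) ^ 2 * (p.choose i * 2⁻¹ ^ p) :=
        Finset.sum_congr rfl fun i _ => by ring
    _ = _ := by rw [h]; linear_combination (-(p : ℝ) / 4) * h3

/-! ### A variance lower bound for the quantum Fisher information -/

/-- Suppose `ρ = m |ψ⟩⟨ψ| + σ`, where `σ ≥ 0` annihilates both `ψ` and `H ψ`. If `u = (H - μ) ψ` is
orthogonal to `ψ`, so that `μ` is the mean of `H` in `ψ`, then the quantum Fisher information of `ρ`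
is at least `4 m ‖u‖²`, the Fisher information carried by the branch `ψ`. Indeed the equation for
the logarithmic derivative `L` forces `⟨u, L ψ⟩ = -2i ‖u‖²`, hence `‖L ψ‖ ≥ 2 ‖u‖` by
Cauchy–Schwarz, while `tr (ρ L²) ≥ m ‖L ψ‖²`. -/
theorem qfi_ge_of_decomposition {κ : Type} [Fintype κ] [DecidableEq κ] {H σ : Matrix κ κ ℂ}
    {ψ u : κ → ℂ} {m μ : ℝ} (hm : 0 ≤ m) (hσ : σ.PosSemidef) (hH : H.IsHermitian)
    (hu : H *ᵥ ψ = u + (μ : ℂ) • ψ) (huψ : star u ⬝ᵥ ψ = 0)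
    (hσψ : σ *ᵥ ψ = 0) (hσu : σ *ᵥ u = 0) :
    4 * m * (star u ⬝ᵥ u).re ≤ qfi ((m : ℂ) • ketBra ψ + σ) H := by
  set ρ := (m : ℂ) • ketBra ψ + σ with hρdef
  have hρ : ρ.PosSemidef := by
    refine Matrix.PosSemidef.add (Matrix.PosSemidef.smul ?_ (by exact_mod_cast hm)) hσ
    exact Matrix.posSemidef_vecMulVec_self_star ψ
  obtain ⟨L, hL⟩ := IsSLD.exists hρ hH
  rw [hL.qfi_eq]
  have hLh : Lᴴ = L := hL.1
  have hψu : star ψ ⬝ᵥ u = 0 := by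
    rw [Matrix.star_dotProduct, huψ, star_zero]
  have hket : ∀ v : κ → ℂ, ketBra ψ *ᵥ v = (star ψ ⬝ᵥ v) • ψ := by
    intro v
    rw [ketBra, Matrix.vecMulVec_mulVec]
    ext i; simp [mul_comm]
  have hρψ : ρ *ᵥ ψ = ((m : ℂ) * (star ψ ⬝ᵥ ψ)) • ψ := by
    rw [hρdef, Matrix.add_mulVec, Matrix.smul_mulVec, hket, hσψ, add_zero, smul_smul]
  have hρu : ρ *ᵥ u = 0 := by
    rw [hρdef, Matrix.add_mulVec, Matrix.smul_mulVec, hket, hσu, hψu]; simp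
  have hherm : ∀ v w : κ → ℂ, star v ⬝ᵥ (ρ *ᵥ w) = star (ρ *ᵥ v) ⬝ᵥ w := by
    intro v w
    rw [Matrix.star_mulVec, hρ.1.eq, Matrix.dotProduct_mulVec]
  -- The matrix element of the defining equation of `L` between `u` and `ψ`.
  have key : ((m : ℂ) * (star ψ ⬝ᵥ ψ)) * (star u ⬝ᵥ (L *ᵥ ψ))
      = ((m : ℂ) * (star ψ ⬝ᵥ ψ)) * (-2 * Complex.I * (star u ⬝ᵥ u)) := by
    have e := congrArg (fun A => star u ⬝ᵥ (A *ᵥ ψ)) hL.2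
    simp only [Matrix.smul_mulVec, Matrix.sub_mulVec, Matrix.add_mulVec, ← Matrix.mulVec_mulVec,
      hρψ, hu, Matrix.mulVec_add, Matrix.mulVec_smul, hρu, dotProduct_smul, dotProduct_sub,
      dotProduct_add, huψ, hherm, star_zero, zero_dotProduct, dotProduct_zero,
      smul_eq_mul] at e
    linear_combination 2 * (-e)
  have htr : (ρ * (L * L)).trace
      = (m : ℂ) * (star (L *ᵥ ψ) ⬝ᵥ (L *ᵥ ψ)) + (L * σ * Lᴴ).trace := by
    rw [hρdef, Matrix.add_mul, Matrix.trace_add, Matrix.smul_mul, Matrix.trace_smul, smul_eq_mul,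
      hLh, Matrix.trace_mul_comm (L * σ), ← Matrix.mul_assoc L L σ, Matrix.trace_mul_comm (L * L) σ]
    rw [ketBra, Matrix.trace_mul_comm, Matrix.mul_vecMulVec, Matrix.trace_vecMulVec,
      Matrix.star_mulVec, hLh, ← Matrix.mulVec_mulVec, dotProduct_comm,
      Matrix.dotProduct_mulVec]
  have hσL : 0 ≤ (L * σ * Lᴴ).trace.re :=
    (Complex.nonneg_iff.1 (hσ.mul_mul_conjTranspose_same L).trace_nonneg).1
  have hnorm : ∀ v : κ → ℂ, 0 ≤ (star v ⬝ᵥ v).re := fun v =>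
    (Complex.nonneg_iff.1 (dotProduct_star_self_nonneg v)).1
  rw [htr, Complex.add_re, Complex.re_ofReal_mul]
  rcases hm.eq_or_lt with rfl | hm'
  · simpa using hσL
  have hmain : 4 * (star u ⬝ᵥ u).re ≤ (star (L *ᵥ ψ) ⬝ᵥ (L *ᵥ ψ)).re := by
    by_cases hψ : star ψ ⬝ᵥ ψ = 0
    · have hψ0 : ψ = 0 := dotProduct_star_self_eq_zero.1 hψ
      have hu0 : u = 0 := by simpa [hψ0] using hu.symm
      simpa [hu0] using hnorm _
    have hm0 : (m : ℂ) ≠ 0 := by exact_mod_cast hm'.ne'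
    have hLu := mul_left_cancel₀ (mul_ne_zero hm0 hψ) key
    have hLu' : star (L *ᵥ ψ) ⬝ᵥ u = 2 * Complex.I * (star u ⬝ᵥ u) := by
      rw [Matrix.star_dotProduct, hLu]
      have : star (star u ⬝ᵥ u) = star u ⬝ᵥ u := by
        rw [← Matrix.star_dotProduct]
      simp only [star_mul', this]
      simp
    -- Cauchy–Schwarz for `L ψ` and `u`, by way of the vector `L ψ + 2 i u`.
    have h := hnorm (L *ᵥ ψ + (2 * Complex.I) • u)
    have hexp : star (L *ᵥ ψ + (2 * Complex.I) • u) ⬝ᵥ (L *ᵥ ψ + (2 * Complex.I) • u)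
        = star (L *ᵥ ψ) ⬝ᵥ (L *ᵥ ψ) - 4 * (star u ⬝ᵥ u) := by
      simp only [star_add, star_smul, add_dotProduct, dotProduct_add, smul_dotProduct,
        dotProduct_smul, hLu, hLu', smul_eq_mul]
      simp only [star_mul', Complex.star_def, Complex.conj_I, map_ofNat]
      linear_combination (4 * (star u ⬝ᵥ u)) * Complex.I_sq
    rw [hexp, Complex.sub_re] at h
    simp only [Complex.mul_re, Complex.re_ofNat, Complex.im_ofNat, zero_mul, sub_zero] at h
    linarith
  nlinarith [mul_le_mul_of_nonneg_left hmain hm]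

/-! ### Hamming weights -/

theorem generatorZ_eq_diagonal (ι : Type) [Fintype ι] [DecidableEq ι] :
    generatorZ ι = Matrix.diagonal fun x : Bits ι =>
      (((Fintype.card ι : ℝ) - 2 * hammingWt x : ℝ) : ℂ) := by
  have hbit : ∀ b : Fin 2, (-1 : ℂ) ^ (b : ℕ) = 1 - 2 * ((b : ℕ) : ℂ) := by
    intro b; fin_cases b <;> norm_num
  ext x y
  simp only [generatorZ, pauliZ, Matrix.sum_apply, Matrix.diagonal_apply]
  split_ifs with h
  · simp [hbit, hammingWt, Finset.mul_sum]
  · simp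

theorem hammingWt_glue {ι : Type} [Fintype ι] [DecidableEq ι] (S : Finset ι)
    (z : Bits {i // i ∈ S}) (x : Bits {i // i ∉ S}) :
    hammingWt (glue S z x) = hammingWt z + hammingWt x := by
  unfold hammingWt
  rw [← Fintype.sum_subtype_add_sum_subtype (fun i => i ∈ S)]
  congr 1
  · exact Finset.sum_congr (by ext; simp) fun i _ => by simp [glue, i.2]
  · exact Finset.sum_congr (by ext; simp) fun i _ => by simp [glue, i.2]

/-- Summing a function of the Hamming weight over all bit strings groups them by weight. -/
theorem sum_bits_hammingWt (ι : Type) [Fintype ι] [DecidableEq ι] (f : ℕ → ℝ) :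
    ∑ x : Bits ι, f (hammingWt x)
      = ∑ w ∈ Finset.range (Fintype.card ι + 1), ((Fintype.card ι).choose w : ℝ) * f w := by
  have h := Finset.sum_powerset_apply_card (x := (Finset.univ : Finset ι)) f
  simp only [nsmul_eq_mul, Finset.card_univ] at h
  rw [← h, Finset.powerset_univ]
  symm
  refine Fintype.sum_equiv ⟨fun s i => if i ∈ s then 1 else 0,
    fun x => Finset.univ.filter fun i => x i = 1, fun s => by ext; simp, fun x => ?_⟩ _ _ ?_
  · funext i
    have := Fin.exists_fin_two.1 ⟨x i, rfl⟩
    rcases this with h | h <;> simp [h]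
  · intro s
    congr 1
    simp [hammingWt, apply_ite]

/-! ### The gnu probe state after erasure -/

/-- The amplitude of the gnu probe state on a basis state of Hamming weight `w`. It vanishes unless
`w = g * j` with `j ≤ n`. -/
noncomputable def gnuAmp (g n w : ℕ) : ℝ :=
  Real.sqrt ((2 : ℝ)⁻¹ ^ n) * ∑ j ∈ Finset.range (n + 1),
    Real.sqrt (n.choose j) * if w = g * j then 1 / Real.sqrt ((g * n).choose (g * j)) else 0

theorem gnuProbe_eq_gnuAmp (g n : ℕ) (x : Bits (Fin (g * n))) :
    gnuProbe g n x = (gnuAmp g n (hammingWt x) : ℂ) := by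
  simp only [gnuProbe, gnuAmp, dicke, Fintype.card_fin]
  push_cast
  congr 1
  refine Finset.sum_congr rfl fun j _ => ?_
  split_ifs <;> simp

theorem dvd_of_gnuAmp_ne_zero {g n w : ℕ} (h : gnuAmp g n w ≠ 0) : g ∣ w := by
  contrapose! h
  have : ∀ j, w ≠ g * j := fun j hj => h ⟨j, hj⟩
  simp [gnuAmp, this]

/-- When fewer than `g` qubits are erased, the branches in which `1` and `k ≠ 1` ones were lost have
disjoint supports, because the weights in the probe state are multiples of `g`. -/
theorem gnuAmp_mul_eq_zero {g n t w k : ℕ} (hg1 : 1 < g) (hg : t < g) (hk : k ≤ t) (hk1 : k ≠ 1) :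
    gnuAmp g n (w + k) * gnuAmp g n (w + 1) = 0 := by
  by_contra h
  obtain ⟨a, ha⟩ := dvd_of_gnuAmp_ne_zero (left_ne_zero_of_mul h)
  obtain ⟨b, hb⟩ := dvd_of_gnuAmp_ne_zero (right_ne_zero_of_mul h)
  have hd : (g : ℤ) ∣ (k : ℤ) - 1 := ⟨a - b, by push_cast [mul_sub]; zify at ha hb; linarith⟩
  have h0 : (k : ℤ) - 1 = 0 := by
    apply Int.eq_zero_of_abs_lt_dvd hd
    rw [abs_lt]; omega
  omega

theorem gnuAmp_mul_sq {g n j : ℕ} (hg : 0 < g) (hj : j ≤ n) :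
    gnuAmp g n (g * j) ^ 2 = (2 : ℝ)⁻¹ ^ n * (n.choose j / (g * n).choose (g * j)) := by
  have hs : ∑ i ∈ Finset.range (n + 1), Real.sqrt (n.choose i) *
      (if g * j = g * i then 1 / Real.sqrt ((g * n).choose (g * i)) else 0)
      = Real.sqrt (n.choose j) * (1 / Real.sqrt ((g * n).choose (g * j))) := by
    rw [Finset.sum_eq_single_of_mem j (Finset.mem_range.2 (by omega))]
    · simp
    · intro i _ hij
      rw [if_neg, mul_zero]
      exact fun h => hij (Nat.eq_of_mul_eq_mul_left hg h).symm
  rw [gnuAmp, hs, mul_pow, mul_pow, div_pow, Real.sq_sqrt (by positivity),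
    Real.sq_sqrt (by positivity), Real.sq_sqrt (by positivity)]
  ring

theorem card_hammingWt_eq_one {ι : Type} [Fintype ι] [DecidableEq ι] :
    (Finset.univ.filter fun z : Bits ι => hammingWt z = 1).card = Fintype.card ι := by
  have h := sum_bits_hammingWt ι fun w => if w = 1 then 1 else 0
  rw [Finset.sum_boole] at h
  have h2 : ((Finset.univ.filter fun z : Bits ι => hammingWt z = 1).card : ℝ)
      = Fintype.card ι := by
    rw [h]
    simp only [mul_ite, mul_one, mul_zero, Finset.sum_ite_eq', Finset.mem_range]
    split_ifs with hc
    · simp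
    · have : Fintype.card ι = 0 := by omega
      simp [this]
  exact_mod_cast h2

/-- The erased state is a mixture over the contents `z` of the erased register, and its branches
depend on `z` only through its weight. The `S.card` branches of weight one, which all agree, are
split off. -/
theorem eraseQubits_gnuProbe (g n : ℕ) (S : Finset (Fin (g * n))) :
    eraseQubits S (ketBra (gnuProbe g n))
      = ((S.card : ℝ) : ℂ) • ketBra (fun x => (gnuAmp g n (hammingWt x + 1) : ℂ))
        + ∑ z ∈ Finset.univ.filter (fun z : Bits {i // i ∈ S} => hammingWt z ≠ 1),
          ketBra (fun x => (gnuAmp g n (hammingWt x + hammingWt z) : ℂ)) := by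
  have h : eraseQubits S (ketBra (gnuProbe g n)) = ∑ z : Bits {i // i ∈ S},
      ketBra (fun x => (gnuAmp g n (hammingWt x + hammingWt z) : ℂ)) := by
    ext x y
    simp only [eraseQubits, ketBra, Matrix.sum_apply, Matrix.vecMulVec_apply, Pi.star_apply,
      gnuProbe_eq_gnuAmp, hammingWt_glue, add_comm]
  rw [h, ← Finset.sum_filter_add_sum_filter_not _ (fun z => hammingWt z = 1)]
  congr 1
  rw [Finset.sum_congr rfl fun z hz => by rw [(Finset.mem_filter.1 hz).2], Finset.sum_const,
    card_hammingWt_eq_one, Fintype.card_coe, Complex.ofReal_natCast, Nat.cast_smul_eq_nsmul]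

/-- The branch in which exactly one of the erased qubits is a one contributes four times the
(unnormalized) variance of the generator in it; `hμ` says that `μ` is the mean. -/
theorem erasedProbeQFI_ge_variance {g n : ℕ} (S : Finset (Fin (g * n))) (hg1 : 1 < g) (hg : S.card < g)
    (μ : ℝ)
    (hμ : ∑ x : Bits {i // i ∉ S}, ((Fintype.card {i // i ∉ S} : ℝ) - 2 * hammingWt x - μ)
      * gnuAmp g n (hammingWt x + 1) ^ 2 = 0) :
    4 * S.card * ∑ x : Bits {i // i ∉ S},
      ((Fintype.card {i // i ∉ S} : ℝ) - 2 * hammingWt x - μ) ^ 2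
        * gnuAmp g n (hammingWt x + 1) ^ 2 ≤ erasedProbeQFI g n S := by
  set M : ℝ := ((Fintype.card {i // i ∉ S} : ℕ) : ℝ) with hM
  set ψ : Bits {i // i ∉ S} → ℂ := fun x => (gnuAmp g n (hammingWt x + 1) : ℂ) with hψ
  set u : Bits {i // i ∉ S} → ℂ :=
    fun x => ((M - 2 * hammingWt x - μ : ℝ) : ℂ) * gnuAmp g n (hammingWt x + 1) with hu
  set σ : Matrix (Bits {i // i ∉ S}) (Bits {i // i ∉ S}) ℂ :=
    ∑ z ∈ Finset.univ.filter (fun z : Bits {i // i ∈ S} => hammingWt z ≠ 1),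
      ketBra (fun x => (gnuAmp g n (hammingWt x + hammingWt z) : ℂ)) with hσ
  have hkill : ∀ f : Bits {i // i ∉ S} → ℂ,
      σ *ᵥ (fun x => f x * gnuAmp g n (hammingWt x + 1)) = 0 := by
    intro f
    rw [hσ, Matrix.sum_mulVec]
    refine Finset.sum_eq_zero fun z hz => ?_
    have hz1 := (Finset.mem_filter.1 hz).2
    have hzt : hammingWt z ≤ S.card := by
      calc hammingWt z ≤ ∑ _i : {i // i ∈ S}, 1 := Finset.sum_le_sum fun i _ => by omega
        _ = S.card := by simp
    rw [ketBra, Matrix.vecMulVec_mulVec]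
    have : star (fun x => (gnuAmp g n (hammingWt x + hammingWt z) : ℂ)) ⬝ᵥ
        (fun x : Bits {i // i ∉ S} => f x * gnuAmp g n (hammingWt x + 1)) = 0 := by
      refine Finset.sum_eq_zero fun x _ => ?_
      have h0 := gnuAmp_mul_eq_zero (n := n) (w := hammingWt x) hg1 hg hzt hz1
      have h0' : (gnuAmp g n (hammingWt x + hammingWt z) : ℂ)
          * gnuAmp g n (hammingWt x + 1) = 0 := by
        exact_mod_cast h0
      simp only [Pi.star_apply, Complex.star_def, Complex.conj_ofReal]
      linear_combination f x * h0'
    rw [this]; simp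
  have hstar : star u ⬝ᵥ ψ = 0 := by
    have : star u ⬝ᵥ ψ = ((∑ x : Bits {i // i ∉ S}, (M - 2 * hammingWt x - μ)
      * gnuAmp g n (hammingWt x + 1) ^ 2 : ℝ) : ℂ) := by
      push_cast
      refine Finset.sum_congr rfl fun x _ => ?_
      simp only [hu, hψ, Pi.star_apply, star_mul', Complex.star_def, Complex.conj_ofReal]
      push_cast; ring
    rw [this, hμ, Complex.ofReal_zero]
  have huu : (star u ⬝ᵥ u).re = ∑ x : Bits {i // i ∉ S}, (M - 2 * hammingWt x - μ) ^ 2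
      * gnuAmp g n (hammingWt x + 1) ^ 2 := by
    rw [← Complex.ofReal_re (∑ x : Bits {i // i ∉ S}, _)]
    congr 1
    push_cast
    refine Finset.sum_congr rfl fun x _ => ?_
    simp only [hu, Pi.star_apply, star_mul', Complex.star_def, Complex.conj_ofReal]
    push_cast; ring
  rw [erasedProbeQFI, eraseQubits_gnuProbe, ← huu]
  refine qfi_ge_of_decomposition (μ := μ) (Nat.cast_nonneg _) ?_ ?_ ?_ hstar ?_ (hkill _)
  · exact Matrix.posSemidef_sum _ fun z _ => Matrix.posSemidef_vecMulVec_self_star _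
  · rw [generatorZ_eq_diagonal]
    exact Matrix.isHermitian_diagonal_of_self_adjoint _ (by ext; simp)
  · rw [generatorZ_eq_diagonal]
    ext x
    rw [Matrix.mulVec_diagonal]
    simp only [hu, Pi.add_apply, Pi.smul_apply, smul_eq_mul]
    push_cast [hM]; ring
  · simpa using hkill fun _ => 1

/-! ### The variance of one erasure branch -/

/-- The only weights of the remaining `M` qubits that occur after the loss of a single one are
`g * (i + 1) - 1` with `i < n`. -/
theorem sum_gnuAmp_sq {g n M : ℕ} (hg : 0 < g) (hM : M < g * n) (F : ℕ → ℝ) :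
    ∑ w ∈ Finset.range (M + 1), (M.choose w : ℝ) * (F w * gnuAmp g n (w + 1) ^ 2)
      = (2 : ℝ)⁻¹ ^ n * ∑ i ∈ Finset.range n, F (g * (i + 1) - 1) *
        (M.choose (g * (i + 1) - 1) * n.choose (i + 1) / (g * n).choose (g * (i + 1))) := by
  have h1 : ∑ w ∈ Finset.range (M + 1), (M.choose w : ℝ) * (F w * gnuAmp g n (w + 1) ^ 2)
      = ∑ w ∈ Finset.range (g * n), (M.choose w : ℝ) * (F w * gnuAmp g n (w + 1) ^ 2) := by
    -- The weight `g * n - 1` may exceed `M`, but then its binomial coefficient is zero.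
    refine Finset.sum_subset (Finset.range_subset_range.2 hM) fun w _ hw => ?_
    rw [Nat.choose_eq_zero_of_lt (by simpa using hw)]; simp
  rw [h1, Finset.mul_sum]
  symm
  have hpos : ∀ i, g * (i + 1) - 1 + 1 = g * (i + 1) := fun i =>
    Nat.sub_add_cancel (Nat.mul_pos hg i.succ_pos)
  refine Finset.sum_of_injOn (fun i => g * (i + 1) - 1) ?_ ?_ ?_ ?_
  · intro i _ j _ hij
    have h2 : g * (i + 1) = g * (j + 1) := by rw [← hpos i, ← hpos j]; exact congrArg (· + 1) hij
    simpa using Nat.eq_of_mul_eq_mul_left hg h2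
  · intro i hi
    have hi : i < n := by simpa using hi
    have := Nat.mul_le_mul_left g hi
    have := hpos i
    simp only [Finset.coe_range, Set.mem_Iio]
    simp only [Nat.succ_eq_add_one] at *
    omega
  · intro w hw hne
    have hw : w < g * n := by simpa using hw
    suffices gnuAmp g n (w + 1) = 0 by rw [this]; simp
    by_contra h
    obtain ⟨j, hj⟩ := dvd_of_gnuAmp_ne_zero h
    apply hne
    rcases j with _ | i
    · simp at hj
    · refine ⟨i, ?_, by simp only; omega⟩
      have : g * (i + 1) ≤ g * n := by omega
      have := Nat.le_of_mul_le_mul_left this hg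
      simp only [Finset.coe_range, Set.mem_Iio]; omega
  · intro i hi
    have hi : i + 1 ≤ n := by simpa using hi
    simp only [hpos, gnuAmp_mul_sq hg hi]
    ring

/-- If the weight distribution of the branch that lost a single one is, in terms of `i` with weight
`g * (i + 1) - 1`, a multiple `c` of the binomial distribution with `n - t` trials, then its
variance is explicit and gives a lower bound on the quantum Fisher information. -/
theorem erasedProbeQFI_ge_of_binomial {g n t : ℕ} (hg1 : 1 < g) (hg : t < g) (ht : 0 < t)
    (htn : t ≤ n) {c : ℝ}
    (hc : ∀ i < n, ((g * n - t).choose (g * (i + 1) - 1) : ℝ) * n.choose (i + 1)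
      / (g * n).choose (g * (i + 1)) = c * (n - t).choose i)
    (S : Finset (Fin (g * n))) (hS : S.card = t) :
    4 * t * (c * (2 : ℝ)⁻¹ ^ t * g ^ 2 * (n - t)) ≤ erasedProbeQFI g n S := by
  have hM : Fintype.card {i // i ∉ S} = g * n - t := by
    rw [Fintype.card_subtype_compl, Fintype.card_fin, Fintype.card_coe, hS]
  have hgn : 0 < g * n := Nat.mul_pos (by omega) (by omega)
  -- The mean of the generator: `i` has mean `(n - t) / 2`.
  set μ : ℝ := ((g * n - t : ℕ) : ℝ) + 2 - 2 * g - g * (n - t : ℕ) with hμ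
  have hsum : ∀ F : ℝ → ℝ, ∑ x : Bits {i // i ∉ S},
      F ((Fintype.card {i // i ∉ S} : ℝ) - 2 * hammingWt x - μ) * gnuAmp g n (hammingWt x + 1) ^ 2
      = (2 : ℝ)⁻¹ ^ n * c * ∑ i ∈ Finset.range (n - t + 1),
        ((n - t).choose i : ℝ) * F (-2 * g * ((i : ℝ) - (n - t : ℕ) / 2)) := by
    intro F
    rw [sum_bits_hammingWt _ fun w =>
      F ((Fintype.card {i // i ∉ S} : ℝ) - 2 * w - μ) * gnuAmp g n (w + 1) ^ 2, hM,
      sum_gnuAmp_sq (by omega) (by omega) fun w => F (((g * n - t : ℕ) : ℝ) - 2 * w - μ),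
      mul_assoc, Finset.mul_sum (Finset.range (n - t + 1))]
    congr 1
    symm
    refine Finset.sum_subset_zero_on_sdiff (Finset.range_subset_range.2 (by omega)) ?_ ?_
    · intro i hi
      simp only [Finset.mem_sdiff, Finset.mem_range] at hi
      rw [hc i hi.1, Nat.choose_eq_zero_of_lt (by omega)]; simp
    · intro i hi
      have hi : i < n := by simp only [Finset.mem_range] at hi; omega
      have hw : ((g * (i + 1) - 1 : ℕ) : ℝ) = g * (i + 1) - 1 := by
        rw [Nat.cast_sub (Nat.mul_pos (by omega) i.succ_pos)]; push_cast; ring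
      rw [hc i hi, hw, hμ, show ((g * n - t : ℕ) : ℝ) - 2 * (g * (i + 1) - 1)
        - (((g * n - t : ℕ) : ℝ) + 2 - 2 * g - g * (n - t : ℕ))
        = -2 * g * ((i : ℝ) - (n - t : ℕ) / 2) by ring]
      ring
  have h1 : ∑ x : Bits {i // i ∉ S}, ((Fintype.card {i // i ∉ S} : ℝ) - 2 * hammingWt x - μ)
      * gnuAmp g n (hammingWt x + 1) ^ 2 = 0 := by
    rw [hsum fun y => y]
    have : ∑ i ∈ Finset.range (n - t + 1),
        ((n - t).choose i : ℝ) * (-2 * g * ((i : ℝ) - (n - t : ℕ) / 2))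
        = -2 * g * ∑ i ∈ Finset.range (n - t + 1),
          ((n - t).choose i : ℝ) * ((i : ℝ) - (n - t : ℕ) / 2) := by
      rw [Finset.mul_sum]
      exact Finset.sum_congr rfl fun i _ => by ring
    rw [this, sum_choose_mul_sub_half]; ring
  have h2 := erasedProbeQFI_ge_variance S hg1 (hS ▸ hg) μ h1
  rw [hsum fun y => y ^ 2] at h2
  have h3 : ∑ i ∈ Finset.range (n - t + 1),
      ((n - t).choose i : ℝ) * (-2 * g * ((i : ℝ) - (n - t : ℕ) / 2)) ^ 2
      = 4 * (g : ℝ) ^ 2 * ∑ i ∈ Finset.range (n - t + 1),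
        ((n - t).choose i : ℝ) * ((i : ℝ) - (n - t : ℕ) / 2) ^ 2 := by
    rw [Finset.mul_sum]
    exact Finset.sum_congr rfl fun i _ => by ring
  rw [h3, sum_choose_mul_sub_half_sq, hS] at h2
  refine le_of_eq_of_le ?_ h2
  have h4 : (2 : ℝ)⁻¹ ^ n = 2⁻¹ ^ t * 2⁻¹ ^ (n - t) := by
    rw [← pow_add, Nat.add_sub_cancel' htn]
  have h5 : (2⁻¹ : ℝ) ^ (n - t) * 2 ^ (n - t) = 1 := by rw [← mul_pow]; norm_num
  rw [h4, Nat.cast_sub htn]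
  linear_combination (-(4 : ℝ) * t * c * 2⁻¹ ^ t * g ^ 2 * (n - t)) * h5

/-! ### One and two erasures -/

/-- `(m+2)(m+1) C(m,i) = C(m+2,i+1) (i+1) (m+1-i)`; it holds also for `i = m + 1`, where both sides
vanish. -/
theorem choose_two_step (m i : ℕ) :
    ((m : ℝ) + 2) * (m + 1) * m.choose i = (m + 2).choose (i + 1) * (i + 1) * (m + 1 - i) := by
  have h1 : ((m : ℝ) + 2) * (m + 1).choose i = (m + 2).choose (i + 1) * (i + 1) := by
    have := Nat.add_one_mul_choose_eq (m + 1) i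
    push_cast [← @Nat.cast_inj ℝ] at this
    linear_combination this
  have h2 : (m.choose i : ℝ) * (m + 1) = (m + 1).choose i * (m + 1 - i) := by
    rcases le_or_gt i (m + 1) with h | h
    · have := Nat.choose_mul_succ_eq m i
      have h' : ((m + 1 - i : ℕ) : ℝ) = m + 1 - i := by push_cast [Nat.cast_sub h]; ring
      rw [← h']
      exact_mod_cast this
    · rw [Nat.choose_eq_zero_of_lt h, Nat.choose_eq_zero_of_lt (by omega)]; simp
  linear_combination ((m : ℝ) + 2) * h2 + (m + 1 - i) * h1

theorem erasedProbeQFI_ge_one {g n : ℕ} (hn : 1 < n) (hg : 1 < g)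
    (S : Finset (Fin (g * n))) (hS : S.card = 1) :
    2 * ((n : ℝ) - 1) / n ^ 2 * ((g : ℝ) * n) ^ 2 ≤ erasedProbeQFI g n S := by
  have hn0 : (n : ℝ) ≠ 0 := by positivity
  have h := erasedProbeQFI_ge_of_binomial (c := 1) hg hg one_pos hn.le ?_ S hS
  · refine le_of_eq_of_le ?_ h
    field_simp
    norm_num
  intro i hi
  have hk : g * (i + 1) ≤ g * n := Nat.mul_le_mul_left g hi
  have hk0 : 0 < g * (i + 1) := Nat.mul_pos (by omega) i.succ_pos
  have hch : ((g * n).choose (g * (i + 1)) : ℝ) ≠ 0 := by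
    exact_mod_cast (Nat.choose_pos hk).ne'
  have e1 : ((g : ℝ) * n) * (g * n - 1).choose (g * (i + 1) - 1)
      = (g * n).choose (g * (i + 1)) * (g * (i + 1)) := by
    have := Nat.add_one_mul_choose_eq (g * n - 1) (g * (i + 1) - 1)
    rw [Nat.sub_add_cancel hk0, Nat.sub_add_cancel (hk0.trans_le hk)] at this
    exact_mod_cast this
  have e2 : (n : ℝ) * (n - 1).choose i = n.choose (i + 1) * (i + 1) := by
    have := Nat.add_one_mul_choose_eq (n - 1) i
    rw [Nat.sub_add_cancel (by omega)] at this
    exact_mod_cast this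
  have hg0 : (g : ℝ) ≠ 0 := by positivity
  rw [div_eq_iff hch, one_mul]
  apply mul_left_cancel₀ (mul_ne_zero hg0 hn0)
  linear_combination (n.choose (i + 1) : ℝ) * e1 - g * (g * n).choose (g * (i + 1)) * e2

theorem erasedProbeQFI_ge_two {g n : ℕ} (hn : 2 < n) (hg : 2 < g)
    (S : Finset (Fin (g * n))) (hS : S.card = 2) :
    2 * ((n : ℝ) - 1) * (n - 2) / n ^ 3 * ((g : ℝ) * n) ^ 2 ≤ erasedProbeQFI g n S := by
  have hn0 : (n : ℝ) ≠ 0 := by positivity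
  have hg0 : (g : ℝ) ≠ 0 := by positivity
  have hn2 : (2 : ℝ) < n := by exact_mod_cast hn
  have hg2 : (2 : ℝ) < g := by exact_mod_cast hg
  have hN : (0 : ℝ) < g * n - 1 := by nlinarith
  have h := erasedProbeQFI_ge_of_binomial (c := g * (n - 1) / (g * n - 1)) (t := 2)
    (by omega) hg two_pos hn.le ?_ S hS
  · refine le_trans ?_ h
    have h1 : 1 / (n : ℝ) ≤ g / (g * n - 1) := by
      rw [div_le_div_iff₀ (by positivity) hN]; linarith
    calc 2 * ((n : ℝ) - 1) * (n - 2) / n ^ 3 * ((g : ℝ) * n) ^ 2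
        = 2 * (g : ℝ) ^ 2 * ((n - 1) * (n - 2)) * (1 / n) := by field_simp
      _ ≤ 2 * (g : ℝ) ^ 2 * ((n - 1) * (n - 2)) * (g / (g * n - 1)) :=
        mul_le_mul_of_nonneg_left h1 (mul_nonneg (by positivity)
          (mul_nonneg (by linarith) (by linarith)))
      _ = _ := by push_cast; ring
  intro i hi
  have hk : g * (i + 1) ≤ g * n := Nat.mul_le_mul_left g hi
  have hk0 : 0 < g * (i + 1) := Nat.mul_pos (by omega) i.succ_pos
  have hch : ((g * n).choose (g * (i + 1)) : ℝ) ≠ 0 := by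
    exact_mod_cast (Nat.choose_pos hk).ne'
  have hgn : 2 ≤ g * n := by nlinarith
  have e1 : ((g : ℝ) * n) * (g * n - 1) * (g * n - 2).choose (g * (i + 1) - 1)
      = (g * n).choose (g * (i + 1)) * (g * (i + 1)) * (g * (n - (i + 1))) := by
    have := choose_two_step (g * n - 2) (g * (i + 1) - 1)
    rw [Nat.sub_add_cancel hgn, Nat.sub_add_cancel hk0, Nat.cast_sub hgn, Nat.cast_sub hk0] at this
    push_cast at this
    linear_combination this
  have e2 : (n : ℝ) * (n - 1) * (n - 2).choose i = n.choose (i + 1) * (i + 1) * (n - (i + 1)) := by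
    have := choose_two_step (n - 2) i
    rw [Nat.sub_add_cancel hn.le, Nat.cast_sub hn.le] at this
    push_cast at this
    linear_combination this
  rw [div_eq_iff hch, div_mul_eq_mul_div, div_mul_eq_mul_div, eq_div_iff hN.ne']
  apply mul_left_cancel₀ (mul_ne_zero hg0 hn0)
  linear_combination (n.choose (i + 1) : ℝ) * e1 - g ^ 2 * (g * n).choose (g * (i + 1)) * e2

theorem theorem2 (n : ℕ) :
    (1 < n → ∀ᶠ g : ℕ in atTop, ∀ N : ℝ, N = g * n →
      ∀ S : Finset (Fin (g * n)), S.card = 1 →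
        ((n : ℝ) - 1) / (n : ℝ) ^ 2 * (N ^ 2 + ((n : ℝ) - 2) * N - ((n : ℝ) - 1))
          ≤ erasedProbeQFI g n S) ∧
    (2 < n → ∀ᶠ g : ℕ in atTop, ∀ N : ℝ, N = g * n →
      ∀ S : Finset (Fin (g * n)), S.card = 2 →
        (N - 2) * ((n : ℝ) - 1) *
            (N * (3 * (n : ℝ) ^ 2 - n + 6) + 3 * (n : ℝ) ^ 3 - 4 * (n : ℝ) ^ 2 + 3 * n - 18)
            / (8 * (n : ℝ) ^ 4)
          ≤ erasedProbeQFI g n S) ∧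
    (∀ t : ℕ, t = 1 ∨ t = 2 → t < n → ∃ c : ℝ, 0 < c ∧
      ∀ᶠ g : ℕ in atTop, ∀ N : ℝ, N = g * n →
        ∀ S : Finset (Fin (g * n)), S.card = t → c * N ^ 2 ≤ erasedProbeQFI g n S) := by
  refine ⟨fun hn => ?_, fun hn => ?_, ?_⟩
  · filter_upwards [eventually_gt_atTop 1] with g hg N hN S hS
    refine le_trans ?_ (erasedProbeQFI_ge_one hn hg S hS)
    have hn1 : (1 : ℝ) < n := by exact_mod_cast hn
    have hg1 : (1 : ℝ) < g := by exact_mod_cast hg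
    have hNn : (n : ℝ) ≤ N := by rw [hN]; nlinarith
    rw [← hN, show 2 * ((n : ℝ) - 1) / n ^ 2 * N ^ 2 = (n - 1) / n ^ 2 * (2 * N ^ 2) by ring]
    refine mul_le_mul_of_nonneg_left ?_ (div_nonneg (by linarith) (by positivity))
    nlinarith
  · filter_upwards [eventually_gt_atTop 2, eventually_ge_atTop (n ^ 2)] with g hg hgn N hN S hS
    refine le_trans ?_ (erasedProbeQFI_ge_two hn hg S hS)
    have hn3 : (3 : ℝ) ≤ n := by exact_mod_cast hn
    have hgn' : (n : ℝ) ^ 2 ≤ g := by exact_mod_cast hgn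
    have hNn : (n : ℝ) ^ 3 ≤ N := by rw [hN]; nlinarith
    rw [← hN, div_le_iff₀ (by positivity)]
    have hN0 : 0 ≤ N := le_trans (by positivity) hNn
    rw [show 2 * ((n : ℝ) - 1) * (n - 2) / n ^ 3 * N ^ 2 * (8 * n ^ 4)
      = (n - 1) * (16 * n * (n - 2) * N ^ 2) by field_simp; ring]
    rw [mul_comm (N - 2), mul_assoc]
    refine mul_le_mul_of_nonneg_left ?_ (by linarith)
    have hB : 0 ≤ 3 * (n : ℝ) ^ 3 - 4 * n ^ 2 + 3 * n - 18 := by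
      nlinarith [mul_nonneg (sq_nonneg (n : ℝ)) (sub_nonneg.2 hn3)]
    have hB' : 3 * (n : ℝ) ^ 3 - 4 * n ^ 2 + 3 * n - 18 ≤ 3 * N := by nlinarith
    have hA : 18 ≤ 16 * (n : ℝ) * (n - 2) - (3 * n ^ 2 - n + 6) := by nlinarith
    have hA' : 0 ≤ 3 * (n : ℝ) ^ 2 - n + 6 := by nlinarith
    nlinarith [mul_le_mul_of_nonneg_right hA (sq_nonneg N), mul_le_mul_of_nonneg_right hB' hN0,
      mul_nonneg hN0 hA']
  · rintro t (rfl | rfl) hn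
    · have hn1 : (1 : ℝ) < n := by exact_mod_cast hn
      refine ⟨2 * ((n : ℝ) - 1) / n ^ 2, div_pos (by linarith) (by positivity), ?_⟩
      filter_upwards [eventually_gt_atTop 1] with g hg N hN S hS
      rw [hN]
      exact erasedProbeQFI_ge_one hn hg S hS
    · have hn2 : (2 : ℝ) < n := by exact_mod_cast hn
      refine ⟨2 * ((n : ℝ) - 1) * (n - 2) / n ^ 3,
        div_pos (mul_pos (by linarith) (by linarith)) (by positivity), ?_⟩
      filter_upwards [eventually_gt_atTop 2] with g hg N hN S hS
      rw [hN]
      exact erasedProbeQFI_ge_two hn hg S hS
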